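/- For integers $m\ge 1$, $r\ge 0$ and real $\beta$, let $W_{m,r}(\beta)$ be the number of functions $f:\mathbb{F}_2^m\to\mathbb{F}_2$ that are given by a polynomial in $m$ variables over $\mathbb{F}_2$ of total degree at most $r$ and that satisfy $\Pr_{x}[f(x)=1]\le\beta$, where $x$ is uniform in $\mathbb{F}_2^m$. Write $\binom{m}{\le r}=\sum_{i=0}^{r}\binom{m}{i}$. Theorem 1.2. There is an absolute constant $C$ such that for all integers $m,r,\ell\ge 0$ with $r<m$, writing $\gamma=r/m$, $$W_{m,r}(2^{-\ell})\;\le\;2^{\,C m^4+17\,(c_\gamma \ell+d_\gamma)\,\gamma^{\ell-1}\binom{m}{\le r}},\qquad c_\gamma=\frac{1}{1-\gamma},\quad d_\gamma=\frac{2-\gamma}{(1-\gamma)^2}.$$ Here $0^0=1$, and in the degenerate case $r=\ell=0$ the undefined factor $0^{-1}$ is read as $0$. -/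

import Mathlib

/-- The set of polynomials of degree at most `r` in `m` variables over `𝔽₂`, viewed as functions
`𝔽₂^m → 𝔽₂` (equivalently, the codewords of the Reed-Muller code with parameters `m`, `r`):
all evaluation functions of `m`-variate polynomials of total degree at most `r`. -/
def lowDegreePolys (m r : ℕ) : Set ((Fin m → ZMod 2) → ZMod 2) :=
  {f | ∃ p : MvPolynomial (Fin m) (ZMod 2),
    p.totalDegree ≤ r ∧ ∀ x, MvPolynomial.eval x p = f x}

/-- The relative weight `Pr_x[f(x) = 1]`, for `x` uniform in `𝔽₂^m`. -/
noncomputable def relWeight {m : ℕ} (f : (Fin m → ZMod 2) → ZMod 2) : ℝ :=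
  ({x : Fin m → ZMod 2 | f x = 1}.ncard : ℝ) / 2 ^ m

/-- The weight distribution `W_{m,r}(β)`: the number of polynomials of degree at most `r`
in `m` variables over `𝔽₂` whose relative weight is at most `β`. -/
noncomputable def weightDistribution (m r : ℕ) (β : ℝ) : ℕ :=
  {f : (Fin m → ZMod 2) → ZMod 2 | f ∈ lowDegreePolys m r ∧ relWeight f ≤ β}.ncard

/-- The partial sum of binomial coefficients `∑_{i=0}^{r} binom(m, i)`. -/
def binomLe (m r : ℕ) : ℕ := ∑ i ∈ Finset.range (r + 1), m.choose i

/-- `c_γ = 1 / (1 - γ)`. -/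
noncomputable def cGamma (γ : ℝ) : ℝ := 1 / (1 - γ)

/-- `d_γ = (2 - γ) / (1 - γ)^2`. -/
noncomputable def dGamma (γ : ℝ) : ℝ := (2 - γ) / (1 - γ) ^ 2

/-!
Suppose `h` has density at most `2^{-k}`, `k ≥ 2`, and put `d = k - 1`. The derivative of `h` along a
random `d`-tuple of directions agrees with `h` at `x` unless an odd number of the `2^d - 1` nonzero
combinations of the directions lead from `x` to a one of `h`. This error has probability below
`1/2`, with two different bounds:

* at every point it is at most `1 - ∏_{i=2}^{k} (1 - 2^{-i}) < 0.423` (`prod_le_one_sub_errProb`);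
* by a Bonferroni-type inequality and the first three moments, it is at most `1/3 + τ/6`, where `τ`
  is `4^k` times the probability that `h` equals `1` at `x + a`, `x + b` and `x + a + b`
  (`errProb_le_moments`, `moments_le_affine`). At most points `τ` is small: its mean is at most
  `2^{-k}` (`expect_tripleProb`).

An exponential moment bound for the majority of `17 (k + 2)` derivatives, averaged over `x`, then
shows that some choice of directions makes the majority agree with `h` outside a set of density
`2^{-k-1}` (`exists_majority_approx`).

Now let `f` have degree at most `r` and lie within distance `2^{-k}` of a known centre `G`. Applied to
`h = f - G`, this places `f` within `2^{-k-1}` of a new centre, which depends only on `G`, on the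
`17 (k + 2) (k - 1)` directions, and on `17 (k + 2)` derivatives of `f` of order `k - 1`. For fixed
independent directions such a derivative is a function of degree at most `r - k + 1` in `m - k + 1`
variables, so it takes at most `2^B` values with `B ≤ γ^{k-1} binom(m, ≤ r)`
(`ncard_iterDelta_image_le`, `sum_choose_sub_le`). Hence `log₂` of the maximal number of such `f`
grows by at most `O(m^3) + 17 (k + 2) γ^{k-1} binom(m, ≤ r)` from `k + 1` to `k`. For `k > m` there is
at most one such `f`, and summing over `k ≥ ℓ` gives the theorem, because
`∑_{k ≥ ℓ} (k + 2) γ^{k-1} = (c_γ ℓ + d_γ) γ^{ℓ-1}`. For `ℓ ≤ 1` the total number of polynomials of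
degree at most `r` already satisfies the bound.
-/

/-! ### Derivatives and degree over `𝔽₂` -/

/-- The derivative of `f` in direction `y`. -/
def delta {V : Type*} [AddCommGroup V] (y : V) (f : V → ZMod 2) : V → ZMod 2 :=
  fun x => f (x + y) + f x

/-- `DegLT n f` says that `f` has degree less than `n`, in the coordinate-free sense that all
`n`-fold derivatives of `f` vanish. -/
def DegLT {V : Type*} [AddCommGroup V] : ℕ → (V → ZMod 2) → Prop
  | 0, f => f = 0
  | n + 1, f => ∀ y, DegLT n (delta y f)

section Degree

variable {V : Type*} [AddCommGroup V]

theorem delta_zero_fun (y : V) : delta y (0 : V → ZMod 2) = 0 := by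
  ext x; simp [delta]

theorem delta_add (y : V) (f g : V → ZMod 2) : delta y (f + g) = delta y f + delta y g := by
  ext x; simp only [delta, Pi.add_apply]; ring

theorem delta_mul (y : V) (f g : V → ZMod 2) :
    delta y (f * g) = delta y f * g + f * delta y g + delta y f * delta y g := by
  ext x
  simp only [delta, Pi.mul_apply, Pi.add_apply]
  generalize f (x + y) = a, f x = b, g (x + y) = c, g x = e
  revert a b c e; decide

theorem DegLT.zero (n : ℕ) : DegLT n (0 : V → ZMod 2) := by
  induction n with
  | zero => rfl
  | succ n ih => intro y; rw [delta_zero_fun]; exact ih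

theorem DegLT.succ {n : ℕ} {f : V → ZMod 2} (hf : DegLT n f) : DegLT (n + 1) f := by
  induction n generalizing f with
  | zero => intro y; rw [show f = 0 from hf, delta_zero_fun]; rfl
  | succ n ih => intro y; exact ih (hf y)

theorem DegLT.mono {n k : ℕ} (h : n ≤ k) {f : V → ZMod 2} (hf : DegLT n f) : DegLT k f := by
  induction h with
  | refl => exact hf
  | step _ ih => exact ih.succ

theorem DegLT.add {n : ℕ} {f g : V → ZMod 2} (hf : DegLT n f) (hg : DegLT n g) :
    DegLT n (f + g) := by
  induction n generalizing f g with
  | zero => rw [show f = 0 from hf, show g = 0 from hg, add_zero]; rfl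
  | succ n ih => intro y; rw [delta_add]; exact ih (hf y) (hg y)

theorem DegLT.mul {a b : ℕ} {f g : V → ZMod 2} (hf : DegLT (a + 1) f) (hg : DegLT (b + 1) g) :
    DegLT (a + b + 1) (f * g) := by
  induction hn : a + b generalizing a b f g with
  | zero =>
    obtain ⟨rfl, rfl⟩ : a = 0 ∧ b = 0 := by omega
    intro y
    rw [delta_mul, show delta y f = 0 from hf y, show delta y g = 0 from hg y]
    simp [DegLT]
  | succ n ih =>
    intro y
    rw [delta_mul]
    refine DegLT.add (DegLT.add ?_ ?_) ?_
    · rcases a with _ | a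
      · rw [show delta y f = 0 from hf y, zero_mul]; exact DegLT.zero _
      · exact ih (hf y) hg (by omega)
    · rcases b with _ | b
      · rw [show delta y g = 0 from hg y, mul_zero]; exact DegLT.zero _
      · exact ih hf (hg y) (by omega)
    · rcases a with _ | a
      · rw [show delta y f = 0 from hf y, zero_mul]; exact DegLT.zero _
      · exact ih (hf y) ((hg y).succ) (by omega)

theorem degLT_const (c : ZMod 2) : DegLT 1 (fun _ : V => c) := by
  intro y; ext x; simp [delta, CharTwo.add_self_eq_zero]

theorem DegLT.sum {ι : Type*} {n : ℕ} (s : Finset ι) (f : ι → V → ZMod 2)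
    (hf : ∀ i ∈ s, DegLT n (f i)) : DegLT n (∑ i ∈ s, f i) := by
  classical
  induction s using Finset.induction_on with
  | empty => simpa using DegLT.zero n
  | insert a s ha ih =>
    rw [Finset.sum_insert ha]
    exact (hf a (by simp)).add (ih fun i hi => hf i (by simp [hi]))

theorem DegLT.pow {a : ℕ} {f : V → ZMod 2} (hf : DegLT (a + 1) f) (e : ℕ) :
    DegLT (e * a + 1) (f ^ e) := by
  induction e with
  | zero => rw [pow_zero, zero_mul]; exact degLT_const 1
  | succ e ih =>
    rw [pow_succ, Nat.succ_mul]
    exact ih.mul hf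

theorem DegLT.prod {ι : Type*} (s : Finset ι) (e : ι → ℕ) (f : ι → V → ZMod 2)
    (hf : ∀ i ∈ s, DegLT (e i + 1) (f i)) : DegLT (∑ i ∈ s, e i + 1) (∏ i ∈ s, f i) := by
  classical
  induction s using Finset.induction_on with
  | empty => exact degLT_const 1
  | insert a s ha ih =>
    rw [Finset.sum_insert ha, Finset.prod_insert ha]
    exact (hf a (by simp)).mul (ih fun i hi => hf i (by simp [hi]))

theorem DegLT.comp_addMonoidHom {W : Type*} [AddCommGroup W] (φ : W →+ V) {n : ℕ}
    {f : V → ZMod 2} (hf : DegLT n f) : DegLT n (f ∘ φ) := by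
  induction n generalizing f with
  | zero => rw [show f = 0 from hf]; rfl
  | succ n ih =>
    intro y
    have : delta y (f ∘ φ) = delta (φ y) f ∘ φ := by ext x; simp [delta]
    rw [this]; exact ih (hf _)

end Degree

theorem degLT_of_mem_lowDegreePolys {m r : ℕ} {f : (Fin m → ZMod 2) → ZMod 2}
    (hf : f ∈ lowDegreePolys m r) : DegLT (r + 1) f := by
  obtain ⟨p, hp, hpf⟩ := hf
  have hcoord (i : Fin m) : DegLT 2 (fun x : Fin m → ZMod 2 => x i) := by
    intro y z; ext x
    have key : ∀ a b c : ZMod 2, a + c + b + (a + c) + (a + b + a) = 0 := by decide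
    exact key _ _ _
  have : f = ∑ s ∈ p.support,
      (fun _ => p.coeff s) * ∏ i, (fun x : Fin m → ZMod 2 => x i) ^ s i := by
    ext x
    rw [← hpf x, MvPolynomial.eval_eq']
    simp [Finset.sum_apply, Finset.prod_apply]
  rw [this]
  refine DegLT.sum _ _ fun s hs => ?_
  have h1 := DegLT.prod Finset.univ (fun i => s i * 1)
    (fun i => (fun x : Fin m → ZMod 2 => x i) ^ s i) fun i _ => (hcoord i).pow (a := 1) (s i)
  refine ((degLT_const (p.coeff s)).mul (a := 0) h1).mono ?_
  have h2 := (MvPolynomial.le_totalDegree hs).trans hp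
  rw [Finsupp.sum_fintype _ _ (fun _ => rfl)] at h2
  simpa using h2

/-! ### Counting functions of bounded degree -/

/-- A function of degree `< n` is determined by its restriction to a hyperplane `W`, of degree `< n`,
and by the restriction to `W` of its derivative in a direction outside `W`, of degree `< n - 1`;
Pascal's rule gives the count. -/
theorem card_degLT_le {V : Type*} [AddCommGroup V] [Module (ZMod 2) V] [Finite V] (n : ℕ) :
    Nat.card {f : V → ZMod 2 // DegLT n f} ≤
      2 ^ ∑ i ∈ Finset.range n, (Module.finrank (ZMod 2) V).choose i := by
  induction hm : Module.finrank (ZMod 2) V generalizing V n with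
  | zero =>
    have : Subsingleton V := Module.finrank_zero_iff.mp hm
    rcases n with _ | n
    · have : Subsingleton {f : V → ZMod 2 // DegLT 0 f} :=
        ⟨fun a b => Subtype.ext ((show a.1 = 0 from a.2).trans (show b.1 = 0 from b.2).symm)⟩
      simpa using Finite.card_le_one_iff_subsingleton.mpr this
    · rw [Finset.sum_range_succ']
      simp only [Nat.choose_zero_succ, Finset.sum_const_zero, Nat.choose_self, zero_add, pow_one]
      refine (Nat.card_le_card_of_injective
        (fun f : {f : V → ZMod 2 // DegLT (n + 1) f} => f.1 0) ?_).trans (by simp)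
      intro f g h
      ext x
      rw [Subsingleton.elim x 0]; exact h
  | succ m ih =>
    rcases n with _ | n
    · have : Subsingleton {f : V → ZMod 2 // DegLT 0 f} :=
        ⟨fun a b => Subtype.ext ((show a.1 = 0 from a.2).trans (show b.1 = 0 from b.2).symm)⟩
      simpa using Finite.card_le_one_iff_subsingleton.mpr this
    · have : Nontrivial V := Module.nontrivial_of_finrank_pos (R := ZMod 2) (by omega)
      obtain ⟨y, hy⟩ := exists_ne (0 : V)
      obtain ⟨W, hW⟩ := Submodule.exists_isCompl (Submodule.span (ZMod 2) {y})
      have hfin : Module.Finite (ZMod 2) V := inferInstance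
      have hWm : Module.finrank (ZMod 2) W = m := by
        have := Submodule.finrank_add_eq_of_isCompl hW
        rw [finrank_span_singleton hy] at this
        omega
      let ρ : {f : V → ZMod 2 // DegLT (n + 1) f} →
          {f : W → ZMod 2 // DegLT (n + 1) f} × {f : W → ZMod 2 // DegLT n f} :=
        fun f => (⟨f.1 ∘ W.subtype.toAddMonoidHom, f.2.comp_addMonoidHom _⟩,
          ⟨delta y f.1 ∘ W.subtype.toAddMonoidHom, (f.2 y).comp_addMonoidHom _⟩)
      have hρ : Function.Injective ρ := by
        intro f g h
        have h1 : ∀ w ∈ W, f.1 w = g.1 w := fun w hw =>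
          congrFun (congrArg Subtype.val (congrArg Prod.fst h)) ⟨w, hw⟩
        have h2 : ∀ w ∈ W, f.1 (w + y) + f.1 w = g.1 (w + y) + g.1 w := fun w hw =>
          congrFun (congrArg Subtype.val (congrArg Prod.snd h)) ⟨w, hw⟩
        ext x
        obtain ⟨u, hu, w, hw, rfl⟩ := Submodule.mem_sup.mp
          (show x ∈ Submodule.span (ZMod 2) {y} ⊔ W by rw [hW.sup_eq_top]; trivial)
        obtain ⟨c, rfl⟩ := Submodule.mem_span_singleton.mp hu
        have hc : c = 0 ∨ c = 1 := by clear hu; revert c; decide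
        rcases hc with rfl | rfl
        · simpa using h1 w hw
        · have := h2 w hw
          rw [h1 w hw] at this
          rw [one_smul, add_comm y w]
          exact add_right_cancel this
      refine (Nat.card_le_card_of_injective ρ hρ).trans ?_
      rw [Nat.card_prod]
      refine (Nat.mul_le_mul (ih (n + 1) hWm) (ih n hWm)).trans ?_
      rw [← pow_add]
      apply le_of_eq
      congr 1
      rw [Finset.sum_range_succ' (fun i => (m + 1).choose i),
        Finset.sum_range_succ' (fun i => m.choose i)]
      simp only [Nat.choose_succ_succ', Finset.sum_add_distrib, Nat.choose_zero_right]
      ring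

/-! ### Iterated derivatives -/

section Iterated

variable {V : Type*} [AddCommGroup V] [Module (ZMod 2) V]

/-- The linear map `𝔽₂^d → V` sending the standard basis to the directions `Y`. -/
def combo {d : ℕ} (Y : Fin d → V) : (Fin d → ZMod 2) →ₗ[ZMod 2] V :=
  Fintype.linearCombination (ZMod 2) Y

/-- The `d`-fold derivative of `f` in the directions `Y`, as the sum of `f` over the (multi)set
`x + span Y`. -/
def iterDelta {d : ℕ} (Y : Fin d → V) (f : V → ZMod 2) : V → ZMod 2 :=
  fun x => ∑ v, f (x + combo Y v)

theorem combo_apply {d : ℕ} (Y : Fin d → V) (v : Fin d → ZMod 2) :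
    combo Y v = ∑ i, v i • Y i := Fintype.linearCombination_apply _ _ _

theorem iterDelta_zero_dir (Y : Fin 0 → V) (f : V → ZMod 2) : iterDelta Y f = f := by
  ext x; simp [iterDelta, combo_apply]

theorem iterDelta_cons {d : ℕ} (y : V) (Y : Fin d → V) (f : V → ZMod 2) :
    iterDelta (Fin.cons y Y : Fin (d + 1) → V) f = delta y (iterDelta Y f) := by
  ext x
  simp only [iterDelta, delta]
  rw [← (Fin.consEquiv fun _ => ZMod 2).sum_comp, Fintype.sum_prod_type]
  have h2 : ∀ g : ZMod 2 → ZMod 2, ∑ c, g c = g 1 + g 0 := fun g => by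
    rw [add_comm]; exact Fin.sum_univ_two g
  rw [h2]
  congr 1
  all_goals
    refine Finset.sum_congr rfl fun v _ => ?_
    simp [combo_apply, Fin.sum_univ_succ, Fin.consEquiv, add_assoc]

theorem iterDelta_sub {d : ℕ} (Y : Fin d → V) (f g : V → ZMod 2) :
    iterDelta Y (f - g) = iterDelta Y f - iterDelta Y g := by
  ext x; simp [iterDelta]

theorem DegLT.iterDelta {n d : ℕ} {f : V → ZMod 2} (hf : DegLT n f) (Y : Fin d → V) :
    DegLT (n - d) (iterDelta Y f) := by
  induction d generalizing n with
  | zero => rwa [iterDelta_zero_dir]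
  | succ d ih =>
    rw [← Fin.cons_self_tail Y, iterDelta_cons]
    have h := ih hf (Fin.tail Y)
    rcases Nat.lt_or_ge d n with hd | hd
    · rw [show n - d = n - (d + 1) + 1 by omega] at h
      exact h _
    · rw [show n - d = 0 by omega] at h
      rw [show _root_.iterDelta (Fin.tail Y) f = 0 from h, delta_zero_fun]
      exact DegLT.zero _

theorem iterDelta_eq_zero_of_not_injective {d : ℕ} (Y : Fin d → V)
    (hY : ¬ Function.Injective (combo Y)) (f : V → ZMod 2) : iterDelta Y f = 0 := by
  rw [← LinearMap.ker_eq_bot, Submodule.eq_bot_iff] at hY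
  push Not at hY
  obtain ⟨v₀, hv₀, hne⟩ := hY
  ext x
  refine Finset.sum_involution (fun v _ => v + v₀) ?_ ?_ (fun _ _ => Finset.mem_univ _) ?_
  · intro v _
    rw [map_add, LinearMap.mem_ker.mp hv₀, add_zero, CharTwo.add_self_eq_zero]
  · intro v _ _ h; exact hne (by simpa using h)
  · intro v _
    ext i
    rw [Pi.add_apply, Pi.add_apply, add_assoc, CharTwo.add_self_eq_zero, add_zero]

theorem iterDelta_add_combo {d : ℕ} (Y : Fin d → V) (f : V → ZMod 2) (x : V)
    (v : Fin d → ZMod 2) : iterDelta Y f (x + combo Y v) = iterDelta Y f x := by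
  simp only [iterDelta]
  exact Fintype.sum_equiv (Equiv.addLeft v) _ _ fun w => by simp [add_assoc]

/-- For fixed directions `Y`, a `d`-fold derivative is invariant under `span Y`, hence a function of
degree `< n - d` on a complement of `span Y`, which has codimension `d` unless the derivative
vanishes identically. -/
theorem ncard_iterDelta_image_le [Finite V] {d : ℕ} (Y : Fin d → V) (n : ℕ) :
    {g : V → ZMod 2 | ∃ f, DegLT n f ∧ iterDelta Y f = g}.ncard ≤
      2 ^ ∑ i ∈ Finset.range (n - d), (Module.finrank (ZMod 2) V - d).choose i := by
  by_cases hY : Function.Injective (combo Y)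
  · obtain ⟨W, hW⟩ := Submodule.exists_isCompl (LinearMap.range (combo Y))
    have hWm : Module.finrank (ZMod 2) W = Module.finrank (ZMod 2) V - d := by
      have := Submodule.finrank_add_eq_of_isCompl hW
      rw [LinearMap.finrank_range_of_inj hY, Module.finrank_fin_fun] at this
      omega
    rw [← hWm]
    refine le_trans ?_ (card_degLT_le (n - d))
    let ρ : {g : V → ZMod 2 | ∃ f, DegLT n f ∧ iterDelta Y f = g} →
        {f : W → ZMod 2 // DegLT (n - d) f} := fun g =>
      ⟨g.1 ∘ W.subtype.toAddMonoidHom, by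
        obtain ⟨f, hf, hg⟩ := g.2
        rw [← hg]; exact (hf.iterDelta Y).comp_addMonoidHom _⟩
    refine Nat.card_le_card_of_injective ρ ?_
    rintro ⟨_, f, hf, rfl⟩ ⟨_, f', hf', rfl⟩ h
    have h1 : ∀ w ∈ W, iterDelta Y f w = iterDelta Y f' w := fun w hw =>
      congrFun (congrArg Subtype.val h) ⟨w, hw⟩
    ext x
    obtain ⟨u, ⟨v, rfl⟩, w, hw, rfl⟩ := Submodule.mem_sup.mp
      (show x ∈ LinearMap.range (combo Y) ⊔ W by rw [hW.sup_eq_top]; trivial)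
    simp only [add_comm _ w, iterDelta_add_combo, h1 w hw]
  · refine le_trans ((Set.ncard_le_one).mpr ?_) Nat.one_le_two_pow
    rintro _ ⟨f, _, rfl⟩ _ ⟨f', _, rfl⟩
    rw [iterDelta_eq_zero_of_not_injective Y hY, iterDelta_eq_zero_of_not_injective Y hY]

end Iterated

/-! ### The error probability of one random derivative -/

section Derivative

open scoped BigOperators

variable {V : Type*} [AddCommGroup V] [Module (ZMod 2) V] [Fintype V]

/-- The real-valued indicator of `h = 1`. -/
noncomputable def ind {V : Type*} (h : V → ZMod 2) (x : V) : ℝ := if h x = 1 then 1 else 0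

/-- The relative weight `Pr_x[h(x) = 1]`. -/
noncomputable def density {V : Type*} [Fintype V] (h : V → ZMod 2) : ℝ := 𝔼 x, ind h x

/-- The probability, over a uniformly random `d`-tuple of directions `Y`, that the value at `x` of the
derivative of `h` along `Y` differs from `h x`. -/
noncomputable def errProb (d : ℕ) (h : V → ZMod 2) (x : V) : ℝ :=
  𝔼 Y : Fin d → V, if iterDelta Y h x ≠ h x then 1 else 0

/-- The probability that `h` equals `1` at `x + a`, `x + b` and `x + a + b`, for `a = z 0` and
`b = z 1` uniform and independent. It measures how much `h` resembles a subspace through `x`. -/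
noncomputable def tripleProb (h : V → ZMod 2) (x : V) : ℝ :=
  𝔼 z : Fin 2 → V, ind h (x + z 0) * ind h (x + z 1) * ind h (x + (z 0 + z 1))

theorem add_self_eq_zero_of_module {M : Type*} [AddCommGroup M] [Module (ZMod 2) M] (a : M) :
    a + a = 0 := by
  rw [← two_smul (ZMod 2) a, show (2 : ZMod 2) = 0 from rfl, zero_smul]

theorem eq_of_add_eq_zero_of_module {M : Type*} [AddCommGroup M] [Module (ZMod 2) M] {a b : M}
    (h : a + b = 0) : a = b :=
  add_right_cancel (h.trans (add_self_eq_zero_of_module b).symm)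

theorem ind_nonneg {V : Type*} (h : V → ZMod 2) (x : V) : 0 ≤ ind h x := by
  unfold ind; split_ifs <;> norm_num

theorem ind_mul_self {V : Type*} (h : V → ZMod 2) (x : V) : ind h x * ind h x = ind h x := by
  unfold ind; split_ifs <;> norm_num

theorem density_nonneg {V : Type*} [Fintype V] (h : V → ZMod 2) : 0 ≤ density h :=
  Finset.expect_nonneg fun x _ => ind_nonneg h x

theorem expect_add_right {G : Type*} [AddCommGroup G] [Fintype G] (F : G → ℝ) (a : G) :
    𝔼 x, F (x + a) = 𝔼 x, F x :=
  Fintype.expect_equiv (Equiv.addRight a) _ _ fun _ => rfl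

theorem expect_add_left {G : Type*} [AddCommGroup G] [Fintype G] (F : G → ℝ) (a : G) :
    𝔼 x, F (a + x) = 𝔼 x, F x :=
  Fintype.expect_equiv (Equiv.addLeft a) _ _ fun _ => rfl

theorem expect_prod_eq_pow {ι : Type*} [Fintype ι] (g : ι → ℝ) (n : ℕ) :
    𝔼 z : Fin n → ι, ∏ i, g (z i) = (𝔼 i, g i) ^ n := by
  rw [Finset.expect_pow, Fintype.piFinset_univ]

theorem expect_fin_succ {ι : Type*} [Fintype ι] {d : ℕ} (F : (Fin (d + 1) → ι) → ℝ) :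
    𝔼 Y, F Y = 𝔼 Y : Fin d → ι, 𝔼 y, F (Fin.cons y Y) := by
  rw [Finset.expect_comm, ← Finset.expect_product', Finset.univ_product_univ]
  exact (Fintype.expect_equiv (Fin.consEquiv fun _ => ι) _ _ fun _ => rfl).symm

/-- Linearly independent combinations of uniformly random vectors are independent and uniform. The
distribution is invariant under every translation, since every value of the combinations is
attained by some choice of the vectors. -/
theorem expect_combo {d n : ℕ} {c : Fin n → Fin d → ZMod 2} (hc : LinearIndependent (ZMod 2) c)
    (F : (Fin n → V) → ℝ) :
    𝔼 Y : Fin d → V, F (fun j => combo Y (c j)) = 𝔼 z, F z := by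
  have hsurj : ∀ z : Fin n → V, ∃ Y : Fin d → V, (fun j => combo Y (c j)) = z := by
    intro z
    obtain ⟨g, hg⟩ := LinearMap.exists_extend
      ((Fintype.linearCombination (ZMod 2) z) ∘ₗ
        (Finsupp.linearEquivFunOnFinite (ZMod 2) (ZMod 2) (Fin n)).toLinearMap ∘ₗ hc.repr)
    refine ⟨fun i => g (Pi.single i 1), ?_⟩
    ext j
    have h1 : combo (fun i => g (Pi.single i 1)) (c j) = g (c j) := by
      rw [combo_apply]
      conv_rhs => rw [pi_eq_sum_univ' (c j)]
      simp [map_sum]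
    have h2 : g (c j) = z j := by
      have := LinearMap.congr_fun hg ⟨c j, Submodule.subset_span ⟨j, rfl⟩⟩
      simp only [LinearMap.comp_apply, Submodule.subtype_apply, LinearEquiv.coe_coe] at this
      rw [this, hc.repr_eq_single j _ rfl]
      simp [Finsupp.linearEquivFunOnFinite_single, Fintype.linearCombination_apply_single]
    rw [h1, h2]
  have key : ∀ z : Fin n → V, 𝔼 Y : Fin d → V, F (fun j => combo Y (c j)) =
      𝔼 Y : Fin d → V, F ((fun j => combo Y (c j)) + z) := by
    intro z
    obtain ⟨Y₀, rfl⟩ := hsurj z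
    rw [← expect_add_right _ Y₀]
    refine Finset.expect_congr rfl fun Y _ => congrArg F ?_
    ext j
    simp [combo_apply, Finset.sum_add_distrib]
  calc 𝔼 Y : Fin d → V, F (fun j => combo Y (c j))
      = 𝔼 z : Fin n → V, 𝔼 Y : Fin d → V, F ((fun j => combo Y (c j)) + z) := by
        rw [← Finset.expect_congr rfl fun z _ => key z, Fintype.expect_const]
    _ = 𝔼 z, F z := by
        rw [Finset.expect_comm]
        simp_rw [expect_add_left F]
        rw [Fintype.expect_const]

theorem linearIndependent_one {d : ℕ} {u : Fin d → ZMod 2} (hu : u ≠ 0) :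
    LinearIndependent (ZMod 2) ![u] := by
  rw [Fintype.linearIndependent_iff]
  intro g hg i
  have hi : i = 0 := Subsingleton.elim _ _
  subst hi
  simpa [hu] using hg

theorem linearIndependent_two {d : ℕ} {u v : Fin d → ZMod 2} (hu : u ≠ 0) (hv : v ≠ 0)
    (huv : v ≠ u) : LinearIndependent (ZMod 2) ![u, v] := by
  rw [LinearIndependent.pair_iff]
  have h2 : ∀ c : ZMod 2, c = 0 ∨ c = 1 := by decide
  intro s t h
  rcases h2 s with rfl | rfl <;> rcases h2 t with rfl | rfl
  · simp
  · simp_all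
  · simp_all
  · rw [one_smul, one_smul] at h
    exact absurd (eq_of_add_eq_zero_of_module h).symm huv

theorem linearIndependent_three {d : ℕ} {u v w : Fin d → ZMod 2} (hu : u ≠ 0) (hv : v ≠ 0)
    (hw : w ≠ 0) (huv : v ≠ u) (hwu : w ≠ u) (hwv : w ≠ v) (hs : w ≠ u + v) :
    LinearIndependent (ZMod 2) ![u, v, w] := by
  have h2 : ∀ c : ZMod 2, c = 0 ∨ c = 1 := by decide
  rw [Fintype.linearIndependent_iff]
  intro g hg
  simp only [Fin.sum_univ_three, Matrix.cons_val_zero, Matrix.cons_val_one,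
    Matrix.cons_val_two] at hg
  have : g 0 = 0 ∧ g 1 = 0 ∧ g 2 = 0 := by
    rcases h2 (g 0) with h0 | h0 <;> rcases h2 (g 1) with h1 | h1 <;>
      rcases h2 (g 2) with h3 | h3 <;> simp only [h0, h1, h3, zero_smul, one_smul, add_zero,
        zero_add] at hg ⊢
    · simp
    · exact absurd hg hw
    · exact absurd hg hv
    · exact absurd (eq_of_add_eq_zero_of_module hg).symm hwv
    · exact absurd hg hu
    · exact absurd (eq_of_add_eq_zero_of_module hg).symm hwu
    · exact absurd (eq_of_add_eq_zero_of_module hg).symm huv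
    · exact absurd (eq_of_add_eq_zero_of_module hg).symm hs
  intro i
  fin_cases i
  exacts [this.1, this.2.1, this.2.2]

theorem density_translate {V : Type*} [AddCommGroup V] [Fintype V] (h : V → ZMod 2)
    (x : V) : 𝔼 a, ind h (x + a) = density h :=
  expect_add_left (ind h) x

theorem tripleProb_nonneg {V : Type*} [AddCommGroup V] [Fintype V] (h : V → ZMod 2)
    (x : V) : 0 ≤ tripleProb h x :=
  Finset.expect_nonneg fun _ _ =>
    mul_nonneg (mul_nonneg (ind_nonneg _ _) (ind_nonneg _ _)) (ind_nonneg _ _)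

/-- On average over `x`, the three points `x + a`, `x + b`, `x + a + b` are independent. -/
theorem expect_tripleProb (h : V → ZMod 2) : 𝔼 x, tripleProb h x = density h ^ 3 := by
  have hx : ∀ x : V, tripleProb h x =
      𝔼 z : Fin 2 → V, ind h (z 0) * ind h (z 1) * ind h (x + (z 0 + z 1)) := by
    intro x
    rw [← expect_add_right _ (fun _ : Fin 2 => x)]
    refine Finset.expect_congr rfl fun z _ => ?_
    simp only [Pi.add_apply]
    have e2 : x + (z 0 + x + (z 1 + x)) = x + (z 0 + z 1) := by
      rw [show x + (z 0 + x + (z 1 + x)) = x + (z 0 + z 1) + (x + x) by abel,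
        add_self_eq_zero_of_module, add_zero]
    rw [e2, add_comm (z 0) x, add_comm (z 1) x]
  simp_rw [hx]
  rw [Finset.expect_comm]
  simp_rw [← Finset.mul_expect]
  have hz : ∀ z : Fin 2 → V, 𝔼 x, ind h (x + (z 0 + z 1)) = density h := fun z =>
    expect_add_right (ind h) _
  simp_rw [hz, ← Finset.expect_mul]
  rw [pow_succ, density, ← expect_prod_eq_pow]
  simp_rw [Fin.prod_univ_two]

theorem sum_mul_sum_sub_one {ι : Type*} [DecidableEq ι] (s : Finset ι) (a : ι → ℝ)
    (ha : ∀ i, a i * a i = a i) :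
    (∑ i ∈ s, a i) * (∑ i ∈ s, a i - 1) = ∑ u ∈ s, ∑ v ∈ s.erase u, a u * a v := by
  rw [Finset.sum_mul]
  refine Finset.sum_congr rfl fun u hu => ?_
  rw [← Finset.mul_sum, ← Finset.add_sum_erase s a hu]
  linear_combination ha u

theorem sum_mul_sum_sub_one_mul_sum_sub_two {ι : Type*} [DecidableEq ι] (s : Finset ι) (a : ι → ℝ)
    (ha : ∀ i, a i * a i = a i) :
    (∑ i ∈ s, a i) * (∑ i ∈ s, a i - 1) * (∑ i ∈ s, a i - 2) =
      ∑ u ∈ s, ∑ v ∈ s.erase u, ∑ w ∈ (s.erase u).erase v, a u * a v * a w := by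
  rw [sum_mul_sum_sub_one s a ha, Finset.sum_mul]
  refine Finset.sum_congr rfl fun u hu => ?_
  rw [Finset.sum_mul]
  refine Finset.sum_congr rfl fun v hv => ?_
  rw [← Finset.mul_sum, ← Finset.add_sum_erase s a hu, ← Finset.add_sum_erase _ a hv]
  linear_combination a v * ha u + a u * ha v

/-- A derivative along `Y` errs at `x` iff the number `X` of nonzero combinations of `Y` that lead
from `x` to a one of `h` is odd; the parity of `X` is at most
`X - 2 * X.choose 2 + 4 * X.choose 3`. -/
theorem err_le_cubic {V : Type*} [AddCommGroup V] [Module (ZMod 2) V] {d : ℕ}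
    (Y : Fin d → V) (h : V → ZMod 2) (x : V) (X : ℝ)
    (hX : X = ∑ v ∈ Finset.univ.erase 0, ind h (x + combo Y v)) :
    (if iterDelta Y h x ≠ h x then (1 : ℝ) else 0) ≤
      X - X * (X - 1) + 2 / 3 * (X * (X - 1) * (X - 2)) := by
  set n : ℕ := ((Finset.univ.erase (0 : Fin d → ZMod 2)).filter
    fun v => h (x + combo Y v) = 1).card with hn
  have hXn : X = n := by
    rw [hX, hn]; simp [ind]
  have hiter : iterDelta Y h x = h x + n := by
    have hcast : ∀ c : ZMod 2, c = if c = 1 then 1 else 0 := by decide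
    rw [iterDelta, ← Finset.add_sum_erase _ _ (Finset.mem_univ 0), map_zero, add_zero, hn,
      Finset.natCast_card_filter]
    congr 1
    exact Finset.sum_congr rfl fun v _ => hcast _
  rw [hXn, show (n : ℝ) - n * (n - 1) + 2 / 3 * (n * (n - 1) * (n - 2)) =
    n * (2 * n - 5) * (n - 2) / 3 by ring]
  rcases Nat.lt_or_ge n 3 with h3 | h3
  · have h22 : ((2 : ℕ) : ZMod 2) = 0 := rfl
    interval_cases n
    · simp [hiter]
    · split_ifs <;> norm_num
    · rw [if_neg]
      · norm_num
      · rw [hiter, h22, add_zero]; simp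
  · have h3' : (3 : ℝ) ≤ n := by exact_mod_cast h3
    have : (1 : ℝ) ≤ n * (2 * n - 5) * (n - 2) / 3 := by
      have h4 : (3 : ℝ) * 1 ≤ n * (2 * n - 5) := by
        apply mul_le_mul h3' (by linarith) (by norm_num) (by linarith)
      nlinarith
    split_ifs
    · exact this
    · linarith

/-- The bound for the error probability by the first three moments of `X`. Only the triples
`u, v, u + v` of combinations fail to be independent, and they contribute `tripleProb`. -/
theorem errProb_le_moments (d : ℕ) (h : V → ZMod 2) (x : V) {N p : ℝ} (hN : N = 2 ^ d - 1)
    (hp : p = density h) :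
    errProb d h x ≤ N * p - N * (N - 1) * p ^ 2 +
      2 / 3 * (N * (N - 1)) * ((N - 3) * p ^ 3 + tripleProb h x) := by
  set s : Finset (Fin d → ZMod 2) := Finset.univ.erase 0 with hs
  set a : (Fin d → V) → (Fin d → ZMod 2) → ℝ := fun Y v => ind h (x + combo Y v) with ha
  have hcard : (s.card : ℝ) = N := by
    rw [hs, Finset.cast_card_erase_of_mem (Finset.mem_univ _)]
    simp [hN]
  have haa : ∀ Y i, a Y i * a Y i = a Y i := fun Y i => ind_mul_self _ _
  have hpow : ∀ {n : ℕ} {c : Fin n → Fin d → ZMod 2}, LinearIndependent (ZMod 2) c →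
      𝔼 Y, ∏ j, a Y (c j) = p ^ n := by
    intro n c hc
    rw [expect_combo hc (fun z => ∏ j, ind h (x + z j)),
      expect_prod_eq_pow (fun y => ind h (x + y)), density_translate, hp]
  have m1 : 𝔼 Y, ∑ v ∈ s, a Y v = N * p := by
    rw [Finset.expect_sum_comm, ← hcard, ← nsmul_eq_mul, ← Finset.sum_const]
    refine Finset.sum_congr rfl fun u hu => ?_
    simpa using hpow (linearIndependent_one (Finset.ne_of_mem_erase hu))
  have hcard' : ∀ u ∈ s, ((s.erase u).card : ℝ) = N - 1 := fun u hu => by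
    rw [Finset.cast_card_erase_of_mem hu, hcard]
  have m2 : 𝔼 Y, (∑ v ∈ s, a Y v) * (∑ v ∈ s, a Y v - 1) = N * (N - 1) * p ^ 2 := by
    simp_rw [fun Y => sum_mul_sum_sub_one s (a Y) (haa Y)]
    rw [Finset.expect_sum_comm, mul_assoc, ← hcard, ← nsmul_eq_mul, ← Finset.sum_const, hcard]
    refine Finset.sum_congr rfl fun u hu => ?_
    rw [Finset.expect_sum_comm, ← hcard' u hu, ← nsmul_eq_mul, ← Finset.sum_const]
    refine Finset.sum_congr rfl fun v hv => ?_
    have hv' := Finset.mem_erase.mp hv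
    simpa [Fin.prod_univ_two] using hpow (linearIndependent_two (Finset.ne_of_mem_erase hu)
      (Finset.ne_of_mem_erase hv'.2) hv'.1)
  have m3 : 𝔼 Y, (∑ v ∈ s, a Y v) * (∑ v ∈ s, a Y v - 1) * (∑ v ∈ s, a Y v - 2) =
      N * (N - 1) * ((N - 3) * p ^ 3 + tripleProb h x) := by
    simp_rw [fun Y => sum_mul_sum_sub_one_mul_sum_sub_two s (a Y) (haa Y)]
    rw [Finset.expect_sum_comm, mul_assoc, ← hcard, ← nsmul_eq_mul, ← Finset.sum_const, hcard]
    refine Finset.sum_congr rfl fun u hu => ?_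
    rw [Finset.expect_sum_comm, ← hcard' u hu, ← nsmul_eq_mul, ← Finset.sum_const]
    refine Finset.sum_congr rfl fun v hv => ?_
    have hu0 := Finset.ne_of_mem_erase hu
    obtain ⟨hvu, hvs⟩ := Finset.mem_erase.mp hv
    have hv0 := Finset.ne_of_mem_erase hvs
    have hmem : u + v ∈ (s.erase u).erase v := by
      simp only [hs, Finset.mem_erase, Finset.mem_univ, and_true, ne_eq, add_eq_right,
        add_eq_left]
      exact ⟨hu0, hv0, fun h0 => hvu (eq_of_add_eq_zero_of_module h0).symm⟩
    rw [Finset.expect_sum_comm, ← Finset.sum_erase_add _ _ hmem]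
    congr 1
    · have hc3 : ((((s.erase u).erase v).erase (u + v)).card : ℝ) = N - 3 := by
        rw [Finset.cast_card_erase_of_mem hmem, Finset.cast_card_erase_of_mem hv, hcard' u hu]
        ring
      rw [← hc3, ← nsmul_eq_mul, ← Finset.sum_const]
      refine Finset.sum_congr rfl fun w hw => ?_
      simp only [Finset.mem_erase] at hw
      simpa [Fin.prod_univ_three] using hpow (linearIndependent_three hu0 hv0
        (Finset.ne_of_mem_erase hw.2.2.2) hvu hw.2.2.1 hw.2.1 hw.1)
    · rw [tripleProb, ← expect_combo (linearIndependent_two hu0 hv0 hvu)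
        (fun z => ind h (x + z 0) * ind h (x + z 1) * ind h (x + (z 0 + z 1)))]
      refine Finset.expect_congr rfl fun Y _ => ?_
      simp [ha, map_add]
  calc errProb d h x ≤ 𝔼 Y, ((∑ v ∈ s, a Y v) - (∑ v ∈ s, a Y v) * (∑ v ∈ s, a Y v - 1) +
        2 / 3 * ((∑ v ∈ s, a Y v) * (∑ v ∈ s, a Y v - 1) * (∑ v ∈ s, a Y v - 2))) :=
        Finset.expect_le_expect fun Y _ => err_le_cubic Y h x _ rfl
    _ = _ := by
        rw [Finset.expect_add_distrib, Finset.expect_sub_distrib, ← Finset.mul_expect, m1, m2, m3]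
        ring

theorem density_delta_le {V : Type*} [AddCommGroup V] [Fintype V] (y : V) (g : V → ZMod 2) :
    density (delta y g) ≤ 2 * density g := by
  have : ∀ x, ind (delta y g) x ≤ ind g (x + y) + ind g x := by
    intro x
    have h2 : ∀ c e : ZMod 2, (if c + e = 1 then (1 : ℝ) else 0) ≤
        (if c = 1 then 1 else 0) + (if e = 1 then 1 else 0) := by
      have h2 : ∀ c : ZMod 2, c = 0 ∨ c = 1 := by decide
      intro c e
      rcases h2 c with rfl | rfl <;> rcases h2 e with rfl | rfl <;>
        simp [CharTwo.add_self_eq_zero]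
    exact h2 _ _
  calc density (delta y g) ≤ 𝔼 x, (ind g (x + y) + ind g x) :=
        Finset.expect_le_expect fun x _ => this x
    _ = 2 * density g := by
        rw [Finset.expect_add_distrib, expect_add_right (ind g), two_mul, density]

theorem density_iterDelta_le {d : ℕ} (Y : Fin d → V) (h : V → ZMod 2) :
    density (iterDelta Y h) ≤ 2 ^ d * density h := by
  induction d with
  | zero => simp [iterDelta_zero_dir]
  | succ d ih =>
    rw [← Fin.cons_self_tail Y, iterDelta_cons, pow_succ']
    linarith [density_delta_le (Y 0) (iterDelta (Fin.tail Y) h), ih (Fin.tail Y)]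

/-- If the derivative `g` along the first directions is correct at `x`, then the next direction `y`
keeps it correct unless `g (x + y) = 1`, which has probability `density g` for every `x`. -/
theorem prod_le_one_sub_errProb (d : ℕ) (h : V → ZMod 2) (x : V) {P : ℝ} (hP : density h ≤ P)
    (hd : ∀ j < d, 2 ^ j * P ≤ 1) :
    ∏ j ∈ Finset.range d, (1 - 2 ^ j * P) ≤ 1 - errProb d h x := by
  have hgood : ∀ d, 1 - errProb d h x =
      𝔼 Y : Fin d → V, if iterDelta Y h x = h x then (1 : ℝ) else 0 := by
    intro d
    rw [errProb, ← Fintype.expect_one (ι := Fin d → V) (M := ℝ), ← Finset.expect_sub_distrib]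
    refine Finset.expect_congr rfl fun Y _ => ?_
    split_ifs <;> simp_all
  induction d with
  | zero => simp [hgood, iterDelta_zero_dir]
  | succ d ih =>
    rw [Finset.prod_range_succ]
    refine (mul_le_mul_of_nonneg_right (ih fun j hj => hd j (by omega))
      (sub_nonneg.mpr (hd d (by omega)))).trans ?_
    rw [hgood, hgood, expect_fin_succ, Finset.expect_mul]
    refine Finset.expect_le_expect fun Y _ => ?_
    split_ifs with hY
    · have h1 : 𝔼 y, (1 - ind (iterDelta Y h) (x + y)) = 1 - density (iterDelta Y h) := by
        rw [Finset.expect_sub_distrib, Fintype.expect_one, density_translate]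
      have h2 : density (iterDelta Y h) ≤ 2 ^ d * P :=
        (density_iterDelta_le Y h).trans (by gcongr)
      rw [one_mul]
      refine (show 1 - 2 ^ d * P ≤ 1 - density (iterDelta Y h) by linarith).trans ?_
      rw [← h1]
      refine Finset.expect_le_expect fun y _ => ?_
      have h3 : ∀ c : ZMod 2, c ≠ 1 → c = 0 := by decide
      simp only [ind, iterDelta_cons, delta, hY]
      split_ifs with h4 h5 h5
      · norm_num
      · norm_num
      · norm_num
      · exact absurd (by rw [h3 _ h4, zero_add]) h5
    · rw [zero_mul]
      exact Finset.expect_nonneg fun y _ => by split_ifs <;> norm_num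

/-! ### The majority of several derivatives -/

/-- The majority value of a tuple of bits; ties give `0`. -/
def majority {t : ℕ} (b : Fin t → ZMod 2) : ZMod 2 :=
  if t < 2 * (Finset.univ.filter fun i => b i = 1).card then 1 else 0

/-- If the majority is wrong, at least half of the bits are. The weights `5/4` and `4/5` are reciprocal;
`5/4` is close to the optimal `√((1 - q) / q)` over the range of error probabilities `q` that
matters. -/
theorem one_le_prod_of_majority_ne {t : ℕ} (b : Fin t → ZMod 2) (c : ZMod 2)
    (hb : majority b ≠ c) : (1 : ℝ) ≤ ∏ i, if b i ≠ c then 5 / 4 else 4 / 5 := by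
  rw [Finset.prod_ite, Finset.prod_const, Finset.prod_const]
  have hsum := Finset.card_filter_add_card_filter_not (s := (Finset.univ : Finset (Fin t)))
    (fun i => b i ≠ c)
  rw [Finset.card_univ, Fintype.card_fin] at hsum
  have hle : (Finset.univ.filter fun i => ¬ b i ≠ c).card ≤
      (Finset.univ.filter fun i => b i ≠ c).card := by
    have h2 : c = 0 ∨ c = 1 := by clear hb hsum; revert c; decide
    have h3 : ∀ e : ZMod 2, e ≠ 0 ↔ e = 1 := by decide
    unfold majority at hb
    rcases h2 with rfl | rfl
    · simp only [h3] at hsum ⊢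
      have : t < 2 * (Finset.univ.filter fun i => b i = 1).card := by
        by_contra h; simp [h] at hb
      omega
    · have : ¬ t < 2 * (Finset.univ.filter fun i => b i = 1).card := by
        intro h; simp [h] at hb
      simp only [ne_eq, not_not] at hsum ⊢
      omega
  calc (1 : ℝ) = (5 / 4) ^ (Finset.univ.filter fun i => b i ≠ c).card *
        (4 / 5) ^ (Finset.univ.filter fun i => b i ≠ c).card := by
        rw [← mul_pow]; norm_num
    _ ≤ _ := by
        gcongr ?_ * ?_
        exact pow_le_pow_of_le_one (by norm_num) (by norm_num) hle

/-- The exponential moment bound for the probability that a majority of `t` independent derivatives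
errs at `x`. -/
theorem expect_majority_ne_le (d t : ℕ) (h : V → ZMod 2) (x : V) :
    (𝔼 Y : Fin t → Fin d → V,
      if majority (fun i => iterDelta (Y i) h x) ≠ h x then (1 : ℝ) else 0) ≤
      (4 / 5 + 9 / 20 * errProb d h x) ^ t := by
  have h1 : 𝔼 Y : Fin d → V, (if iterDelta Y h x ≠ h x then (5 / 4 : ℝ) else 4 / 5) =
      4 / 5 + 9 / 20 * errProb d h x := by
    rw [errProb, Finset.mul_expect, ← Fintype.expect_const (ι := Fin d → V) (4 / 5 : ℝ),
      ← Finset.expect_add_distrib]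
    refine Finset.expect_congr rfl fun Y _ => ?_
    split_ifs <;> norm_num
  rw [← h1, ← expect_prod_eq_pow]
  refine Finset.expect_le_expect fun Y _ => ?_
  split_ifs with hne
  · exact one_le_prod_of_majority_ne _ _ hne
  · exact Finset.prod_nonneg fun i _ => by split_ifs <;> norm_num

end Derivative

/-! ### Numerical estimates -/

section Numeric

theorem pow_seventeen_mul_add {A : ℝ} {d : ℕ} (hd : 7 ≤ d) :
    A ^ (17 * (d + 3)) = A ^ 170 * (A ^ 17) ^ (d - 7) := by
  rw [← pow_mul, ← pow_add]; congr 1; omega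

/-- The bound at `τ = 0`. With `u = 2^{-d}`, the quantity `(1 - u) (1 + 2u²) / 3` is the third-moment
bound for the error probability, and `4/5 + 9/20 * q` is the mean of a weight `5/4` for an error of
probability `q` and `4/5` otherwise. For `d < 7` the dependence on `u` is needed. -/
theorem affine_zero_pow_le (d : ℕ) (hd : 1 ≤ d) {u : ℝ} (hu : u = (1 / 2) ^ d) :
    (4 / 5 + 9 / 20 * ((1 - u) * (1 + 2 * u ^ 2) / 3)) ^ (17 * (d + 3)) ≤ u / 32 := by
  rcases Nat.lt_or_ge d 7 with h7 | h7
  · subst hu; interval_cases d <;> norm_num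
  · have hu0 : 0 < u := by rw [hu]; positivity
    have hu1 : u ≤ 1 / 2 := by
      rw [hu]; exact pow_le_of_le_one (by norm_num) (by norm_num) (by omega)
    have h0 : 0 ≤ (1 - u) * (1 + 2 * u ^ 2) := mul_nonneg (by linarith) (by positivity)
    have h1 : (1 - u) * (1 + 2 * u ^ 2) ≤ 1 := by nlinarith
    calc (4 / 5 + 9 / 20 * ((1 - u) * (1 + 2 * u ^ 2) / 3)) ^ (17 * (d + 3))
        ≤ (19 / 20) ^ (17 * (d + 3)) := by gcongr; linarith
      _ = (19 / 20) ^ 170 * ((19 / 20) ^ 17) ^ (d - 7) := pow_seventeen_mul_add h7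
      _ ≤ ((1 / 2) ^ 7 / 32) * (1 / 2) ^ (d - 7) := by
          gcongr
          · norm_num
          · norm_num
      _ = u / 32 := by
          rw [hu, div_mul_eq_mul_div, ← pow_add]; congr 2; omega

/-- The third-moment bound at `τ = 1/2`. -/
theorem affine_half_pow_le (d : ℕ) (hd : 1 ≤ d) {u : ℝ} (hu : u = (1 / 2) ^ d) :
    (4 / 5 + 9 / 20 * ((1 - u) * (1 + 2 * u ^ 2) / 3 + (1 - u) * (1 - 2 * u) / 6 * (1 / 2)))
      ^ (17 * (d + 3)) ≤ 1 / 5 := by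
  rcases Nat.lt_or_ge d 7 with h7 | h7
  · subst hu; interval_cases d <;> norm_num
  · have hu0 : 0 < u := by rw [hu]; positivity
    have hu1 : u ≤ 1 / 2 := by
      rw [hu]; exact pow_le_of_le_one (by norm_num) (by norm_num) (by omega)
    have h0 : 0 ≤ (1 - u) * (1 + 2 * u ^ 2) := mul_nonneg (by linarith) (by positivity)
    have h1 : (1 - u) * (1 + 2 * u ^ 2) ≤ 1 := by nlinarith
    have h2 : 0 ≤ (1 - u) * (1 - 2 * u) := mul_nonneg (by linarith) (by linarith)
    have h3 : (1 - u) * (1 - 2 * u) ≤ 1 := by nlinarith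
    calc _ ≤ (79 / 80 : ℝ) ^ (17 * (d + 3)) := by gcongr; linarith
      _ = (79 / 80) ^ 170 * ((79 / 80) ^ 17) ^ (d - 7) := pow_seventeen_mul_add h7
      _ ≤ (1 / 5) * 1 ^ (d - 7) := by
          gcongr
          · norm_num
          · norm_num
      _ = 1 / 5 := by norm_num

/-- A lower bound for `∏_{i=2}^{d+1} (1 - 2^{-i})`; the term `0.6 * 2^{-(d+1)}` makes the induction
work. -/
theorem prod_one_sub_ge (d : ℕ) (hd : 7 ≤ d) :
    (0.577 : ℝ) + 0.6 * (1 / 2) ^ (d + 1) ≤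
      ∏ j ∈ Finset.range d, (1 - 2 ^ j * (1 / 2 : ℝ) ^ (d + 1)) := by
  induction d, hd using Nat.le_induction with
  | base => norm_num [Finset.prod_range_succ]
  | succ d hd ih =>
    rw [Finset.prod_range_succ']
    have h1 : ∀ j, (1 : ℝ) - 2 ^ (j + 1) * (1 / 2) ^ (d + 1 + 1) =
        1 - 2 ^ j * (1 / 2) ^ (d + 1) := fun j => by ring
    simp_rw [h1]
    have hP : (1 / 2 : ℝ) ^ (d + 1) ≤ 1 / 256 := by
      calc (1 / 2 : ℝ) ^ (d + 1) ≤ (1 / 2) ^ 8 :=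
            pow_le_pow_of_le_one (by norm_num) (by norm_num) (by omega)
        _ = 1 / 256 := by norm_num
    have hP0 : (0 : ℝ) < (1 / 2) ^ (d + 1) := by positivity
    rw [pow_succ (1 / 2 : ℝ) (d + 1)]
    set P := (1 / 2 : ℝ) ^ (d + 1)
    calc (0.577 : ℝ) + 0.6 * (P * (1 / 2)) ≤ (0.577 + 0.6 * P) * (1 - 2 ^ 0 * (P * (1 / 2))) := by
          nlinarith
      _ ≤ _ := by
          gcongr
          linarith

/-- The bound that holds at every point, whatever `τ`. -/
theorem affine_max_pow_le (d : ℕ) (hd : 1 ≤ d) :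
    (4 / 5 + 9 / 20 * (1 - ∏ j ∈ Finset.range d, (1 - 2 ^ j * (1 / 2 : ℝ) ^ (d + 1))))
      ^ (17 * (d + 3)) ≤ 1 / 5 := by
  rcases Nat.lt_or_ge d 7 with h7 | h7
  · interval_cases d <;> norm_num [Finset.prod_range_succ]
  · have h1 : 0 ≤ 1 - ∏ j ∈ Finset.range d, (1 - 2 ^ j * (1 / 2 : ℝ) ^ (d + 1)) := by
      refine sub_nonneg.mpr (Finset.prod_le_one (fun j hj => ?_) fun j hj => ?_)
      · rw [sub_nonneg]
        calc (2 : ℝ) ^ j * (1 / 2) ^ (d + 1) ≤ 2 ^ (d + 1) * (1 / 2) ^ (d + 1) := by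
              gcongr
              · norm_num
              · have := Finset.mem_range.mp hj; omega
          _ = 1 := by rw [← mul_pow]; norm_num
      · linarith [show (0 : ℝ) ≤ 2 ^ j * (1 / 2) ^ (d + 1) by positivity]
    have h2 := prod_one_sub_ge d h7
    have h3 : (0 : ℝ) < (1 / 2) ^ (d + 1) := by positivity
    calc _ ≤ (0.99035 : ℝ) ^ (17 * (d + 3)) := by gcongr; linarith
      _ = 0.99035 ^ 170 * (0.99035 ^ 17) ^ (d - 7) := pow_seventeen_mul_add h7
      _ ≤ (1 / 5) * 1 ^ (d - 7) := by
          gcongr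
          · norm_num
          · norm_num
      _ = 1 / 5 := by norm_num

/-- The third-moment bound is increasing in the density; at the largest admissible density
`u / 2`, `u = 2^{-d}`, it is affine in the normalized probability `T / (u / 2)^2`. -/
theorem moments_le_affine (d : ℕ) (hd : 1 ≤ d) {u N p T : ℝ} (hu : u = (1 / 2) ^ d)
    (hN : N = 2 ^ d - 1) (hp0 : 0 ≤ p) (hp : p ≤ u / 2) :
    N * p - N * (N - 1) * p ^ 2 + 2 / 3 * (N * (N - 1)) * ((N - 3) * p ^ 3 + T) ≤
      (1 - u) * (1 + 2 * u ^ 2) / 3 + (1 - u) * (1 - 2 * u) / 6 * (T / (u / 2) ^ 2) := by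
  have hu0 : 0 < u := by rw [hu]; positivity
  have hNu : (N + 1) * u = 1 := by rw [hN, hu]; rw [sub_add_cancel, ← mul_pow]; norm_num
  have hN1 : 1 ≤ N := by
    rw [hN]
    have : (2 : ℝ) ^ 1 ≤ 2 ^ d := pow_le_pow_right₀ (by norm_num) hd
    linarith
  have hN3 : 0 ≤ (N - 1) * (N - 3) := by
    rcases Nat.lt_or_ge d 2 with h2 | h2
    · obtain rfl : d = 1 := by omega
      rw [hN]; norm_num
    · have : (2 : ℝ) ^ 2 ≤ 2 ^ d := pow_le_pow_right₀ (by norm_num) h2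
      exact mul_nonneg (by linarith) (by linarith)
  have hmono : N * p - N * (N - 1) * p ^ 2 + 2 / 3 * (N * (N - 1)) * ((N - 3) * p ^ 3) ≤
      N * (u / 2) - N * (N - 1) * (u / 2) ^ 2 +
        2 / 3 * (N * (N - 1)) * ((N - 3) * (u / 2) ^ 3) := by
    have hb : 0 ≤ 1 - (N - 1) * (u / 2 + p) +
        2 / 3 * ((N - 1) * (N - 3)) * ((u / 2) ^ 2 + u / 2 * p + p ^ 2) := by
      have : 0 ≤ 2 / 3 * ((N - 1) * (N - 3)) * ((u / 2) ^ 2 + u / 2 * p + p ^ 2) := by positivity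
      have : (N - 1) * (u / 2 + p) ≤ (N - 1) * u :=
        mul_le_mul_of_nonneg_left (by linarith) (by linarith)
      nlinarith
    have := mul_nonneg (mul_nonneg (by linarith : 0 ≤ N) (sub_nonneg.mpr hp)) hb
    linear_combination this
  have hNe : N = 1 / u - 1 := by field_simp; linear_combination hNu
  have hval : N * (u / 2) - N * (N - 1) * (u / 2) ^ 2 +
      2 / 3 * (N * (N - 1)) * ((N - 3) * (u / 2) ^ 3) = (1 - u) * (1 + 2 * u ^ 2) / 3 := by
    rw [hNe]; field_simp; ring
  have hT : 2 / 3 * (N * (N - 1)) * T = (1 - u) * (1 - 2 * u) / 6 * (T / (u / 2) ^ 2) := by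
    rw [hNe]; field_simp; ring
  rw [mul_add, ← add_assoc, hT, ← hval]
  linarith

theorem chord_pow_le (n : ℕ) {A B a b τ : ℝ} (hA : 0 ≤ A) (hB : 0 ≤ B) (ha : A ^ n ≤ a)
    (hb : B ^ n ≤ b) (h0 : 0 ≤ τ) (h1 : τ ≤ 1) :
    ((1 - τ) * A + τ * B) ^ n ≤ (1 - τ) * a + τ * b := by
  have hconv := (convexOn_pow (𝕜 := ℝ) n).2 (show A ∈ Set.Ici 0 from hA)
    (show B ∈ Set.Ici 0 from hB) (sub_nonneg.mpr h1) h0 (by ring)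
  simp only [smul_eq_mul] at hconv
  exact hconv.trans (add_le_add (mul_le_mul_of_nonneg_left ha (sub_nonneg.mpr h1))
    (mul_le_mul_of_nonneg_left hb h0))

/-- The probability that the majority errs is bounded by an affine function of `τ`: a chord bounds
the convex function on `[0, 1/2]`, a constant suffices on `[1/2, 1]`. -/
theorem majority_pow_le (d : ℕ) (hd : 1 ≤ d) {u q τ : ℝ} (hu : u = (1 / 2) ^ d)
    (hq0 : 0 ≤ q) (hτ0 : 0 ≤ τ)
    (hq : q ≤ (1 - u) * (1 + 2 * u ^ 2) / 3 + (1 - u) * (1 - 2 * u) / 6 * τ)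
    (hmax : q ≤ 1 - ∏ j ∈ Finset.range d, (1 - 2 ^ j * (1 / 2 : ℝ) ^ (d + 1))) :
    (4 / 5 + 9 / 20 * q) ^ (17 * (d + 3)) ≤ u / 32 + 2 / 5 * τ := by
  have hu0 : 0 < u := by rw [hu]; positivity
  rcases le_total τ (1 / 2) with hτ | hτ
  · have hu1 : u ≤ 1 / 2 := by
      rw [hu]; exact pow_le_of_le_one (by norm_num) (by norm_num) (by omega)
    have h0 : 0 ≤ (1 - u) * (1 + 2 * u ^ 2) := mul_nonneg (by linarith) (by positivity)
    have h2 : 0 ≤ (1 - u) * (1 - 2 * u) := mul_nonneg (by linarith) (by linarith)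
    have hchord := chord_pow_le (17 * (d + 3)) (by positivity) (by positivity)
      (affine_zero_pow_le d hd hu) (affine_half_pow_le d hd hu)
      (show 0 ≤ 2 * τ by linarith) (show 2 * τ ≤ 1 by linarith)
    refine (pow_le_pow_left₀ (by positivity) ?_ _).trans (hchord.trans ?_)
    · linear_combination 9 / 20 * hq
    · linarith [mul_nonneg hτ0 hu0.le]
  · calc (4 / 5 + 9 / 20 * q) ^ (17 * (d + 3)) ≤ _ :=
          pow_le_pow_left₀ (by positivity) (by gcongr) _
      _ ≤ 1 / 5 := affine_max_pow_le d hd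
      _ ≤ _ := by linarith

end Numeric

section Amplify

open scoped BigOperators

variable {V : Type*} [AddCommGroup V] [Module (ZMod 2) V] [Fintype V]

/-- A function of density at most `2^{-(d+1)}` agrees with the majority of `17 * (d + 3)` of its
`d`-fold derivatives, up to a set of density `2^{-(d+2)}`. -/
theorem exists_majority_approx (d : ℕ) (hd : 1 ≤ d) (h : V → ZMod 2)
    (hh : density h ≤ (1 / 2) ^ (d + 1)) :
    ∃ Y : Fin (17 * (d + 3)) → Fin d → V,
      density (h - fun x => majority fun i => iterDelta (Y i) h x) ≤ (1 / 2) ^ (d + 2) := by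
  set t := 17 * (d + 3) with ht
  set u : ℝ := (1 / 2) ^ d with hu
  have hu0 : 0 < u := by positivity
  have hhu : density h ≤ u / 2 := by rw [hu]; exact hh.trans_eq (by ring)
  have hpoint : ∀ x, (𝔼 Y : Fin t → Fin d → V,
      if majority (fun i => iterDelta (Y i) h x) ≠ h x then (1 : ℝ) else 0) ≤
      u / 32 + 2 / 5 * (tripleProb h x / (u / 2) ^ 2) := by
    intro x
    refine (expect_majority_ne_le d t h x).trans (majority_pow_le d hd hu ?_ ?_ ?_ ?_)
    · exact Finset.expect_nonneg fun Y _ => by split_ifs <;> norm_num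
    · have := tripleProb_nonneg h x
      positivity
    · exact (errProb_le_moments d h x rfl rfl).trans
        (moments_le_affine d hd hu rfl (density_nonneg h) hhu)
    · have := prod_le_one_sub_errProb d h x hh fun j hj => by
        calc (2 : ℝ) ^ j * (1 / 2) ^ (d + 1) ≤ 2 ^ (d + 1) * (1 / 2) ^ (d + 1) := by
              gcongr
              · norm_num
              · omega
          _ = 1 := by rw [← mul_pow]; norm_num
      linarith
  have hmean : 𝔼 x, (u / 32 + 2 / 5 * (tripleProb h x / (u / 2) ^ 2)) ≤ (1 / 2) ^ (d + 2) := by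
    rw [Finset.expect_add_distrib, Fintype.expect_const, ← Finset.mul_expect, ← Finset.expect_div,
      expect_tripleProb]
    have h1 : density h ^ 3 / (u / 2) ^ 2 ≤ u / 2 := by
      rw [div_le_iff₀ (by positivity), ← pow_succ']
      exact pow_le_pow_left₀ (density_nonneg h) hhu 3
    have h2 : (1 / 2 : ℝ) ^ (d + 2) = u / 4 := by rw [hu]; ring
    rw [h2]; linarith
  obtain ⟨Y, -, hY⟩ := Finset.exists_le_of_expect_le (s := Finset.univ)
    (f := fun Y : Fin t → Fin d → V =>
      𝔼 x, if majority (fun i => iterDelta (Y i) h x) ≠ h x then (1 : ℝ) else 0)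
    (a := (1 / 2) ^ (d + 2)) Finset.univ_nonempty (by
      rw [Finset.expect_comm]
      exact (Finset.expect_le_expect fun x _ => hpoint x).trans hmean)
  refine ⟨Y, le_trans (le_of_eq ?_) hY⟩
  refine Finset.expect_congr rfl fun x _ => ?_
  have h2 : ∀ a b : ZMod 2, a - b = 1 ↔ b ≠ a := by decide
  simp only [ind, Pi.sub_apply, h2]

/-! ### Counting functions near a centre -/

/-- The functions of degree `< n` within relative distance `2^{-k}` of the centre `G`. -/
def nearby (n k : ℕ) (G : V → ZMod 2) : Set (V → ZMod 2) :=
  {f | DegLT n f ∧ density (f - G) ≤ (1 / 2) ^ k}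

/-- Each `f` near `G` is near the centre `G + F`, where the majority `F` approximates `f - G`. As `G` is
known, `F` is determined by the directions and by the derivatives of `f` itself, which are functions
of low degree. -/
theorem ncard_nearby_le (n d : ℕ) (hd : 1 ≤ d) (G : V → ZMod 2) {M : ℕ}
    (hM : ∀ G' : V → ZMod 2, (nearby n (d + 2) G').ncard ≤ M) :
    (nearby n (d + 1) G).ncard ≤ (Fintype.card V ^ d *
      2 ^ ∑ i ∈ Finset.range (n - d), (Module.finrank (ZMod 2) V - d).choose i) ^ (17 * (d + 3))
      * M := by
  classical
  set t := 17 * (d + 3) with ht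
  set b := ∑ i ∈ Finset.range (n - d), (Module.finrank (ZMod 2) V - d).choose i with hb
  choose! Y hY using fun (f : V → ZMod 2) (hf : f ∈ nearby n (d + 1) G) =>
    exists_majority_approx d hd (f - G) hf.2
  let D : (Fin t → Fin d → V) → Type _ := fun Y =>
    ∀ i, {g : V → ZMod 2 | ∃ f, DegLT n f ∧ iterDelta (Y i) f = g}
  let C : ∀ Y, D Y → V → ZMod 2 := fun Y g =>
    G + fun x => majority fun i => (g i).1 x - iterDelta (Y i) G x
  let Φ : nearby n (d + 1) G → Σ Y, Σ g : D Y, nearby n (d + 2) (C Y g) := fun f =>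
    ⟨Y f, fun i => ⟨iterDelta (Y f i) f, f, f.2.1, rfl⟩, f.1, f.2.1, by
      have h1 := hY f.1 f.2
      simp only [iterDelta_sub, Pi.sub_apply] at h1
      rwa [sub_sub] at h1⟩
  have hΦ : Function.Injective Φ := by
    intro f f' h
    have : ∀ z : Σ Y, Σ g : D Y, nearby n (d + 2) (C Y g), z = Φ f' → z.2.2.1 = f'.1 := by
      rintro z rfl; rfl
    exact Subtype.ext (this _ h)
  have : ∀ Y, Finite (D Y) := fun Y => inferInstanceAs (Finite (∀ i, _))
  have hfin : ∀ Y, Fintype (D Y) := fun Y => Fintype.ofFinite _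
  calc (nearby n (d + 1) G).ncard ≤ Nat.card (Σ Y, Σ g : D Y, nearby n (d + 2) (C Y g)) :=
        Nat.card_le_card_of_injective Φ hΦ
    _ = ∑ Y, ∑ g : D Y, (nearby n (d + 2) (C Y g)).ncard := by
        rw [Nat.card_sigma]
        refine Finset.sum_congr rfl fun Y _ => ?_
        rw [Nat.card_sigma]; rfl
    _ ≤ ∑ Y : Fin t → Fin d → V, (2 ^ b) ^ t * M := by
        refine Finset.sum_le_sum fun Y _ => ?_
        refine (Finset.sum_le_card_nsmul _ _ _ fun g _ => hM _).trans ?_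
        rw [smul_eq_mul]
        gcongr
        rw [Finset.card_univ, ← Nat.card_eq_fintype_card, Nat.card_pi]
        refine (Finset.prod_le_pow_card _ _ _ fun i _ =>
          ncard_iterDelta_image_le (Y i) n).trans (by simp [hb])
    _ = _ := by
        simp only [Finset.sum_const, Finset.card_univ, Fintype.card_fun, Fintype.card_fin,
          smul_eq_mul]
        ring

theorem ncard_nearby_le_one {V : Type*} [AddCommGroup V] [Fintype V] (n k : ℕ)
    (hk : Fintype.card V < 2 ^ k) (G : V → ZMod 2) :
    (nearby n k G).ncard ≤ 1 := by
  have hkey : ∀ f ∈ nearby n k G, f = G := by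
    intro f hf
    by_contra hne
    obtain ⟨x, hx⟩ := Function.ne_iff.mp hne
    have h1 : ind (f - G) x = 1 := by
      have h2 : ∀ a b : ZMod 2, a ≠ b → a - b = 1 := by decide
      simp [ind, h2 _ _ hx]
    have h2 : 1 ≤ ∑ y, ind (f - G) y := by
      rw [← h1]
      exact Finset.single_le_sum (fun y _ => ind_nonneg _ y) (Finset.mem_univ x)
    have h3 := hf.2
    have hc : (0 : ℝ) < Fintype.card V := by exact_mod_cast Fintype.card_pos
    rw [density, Fintype.expect_eq_sum_div_card, div_le_iff₀ hc, one_div, inv_pow,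
      ← div_eq_inv_mul, le_div_iff₀ (by positivity)] at h3
    have h4 : (Fintype.card V : ℝ) < 2 ^ k := by exact_mod_cast hk
    nlinarith [show (0 : ℝ) < 2 ^ k by positivity]
  rw [Set.ncard_le_one]
  intro a ha b hb
  rw [hkey a ha, hkey b hb]

end Amplify

/-! ### Summation over the dyadic weights -/

/-- Passing from `(m, r)` to `(m - 1, r - 1)` shrinks the binomial sum by the factor `r / m`, and the
factor decreases along the way. -/
theorem sum_choose_sub_le {m r : ℕ} (hr : r < m) (d : ℕ) :
    ((∑ i ∈ Finset.range (r + 1 - d), (m - d).choose i : ℕ) : ℝ) ≤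
      ((r : ℝ) / m) ^ d * (binomLe m r : ℝ) := by
  have hm : (0 : ℝ) < m := by exact_mod_cast (by omega : 0 < m)
  induction d with
  | zero => simp [binomLe]
  | succ d ih =>
    rcases Nat.lt_or_ge d r with hd | hd
    · obtain ⟨s, hs⟩ : ∃ s, r = d + s + 1 := ⟨r - d - 1, by omega⟩
      obtain ⟨k, hk⟩ : ∃ k, m = d + k + 1 := ⟨m - d - 1, by omega⟩
      have hk0 : (0 : ℝ) < (k : ℝ) + 1 := by positivity
      have h1 : (k + 1) * ∑ i ∈ Finset.range (s + 1), k.choose i ≤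
          (s + 1) * ∑ i ∈ Finset.range (s + 2), (k + 1).choose i := by
        rw [Finset.sum_range_succ' _ (s + 1), mul_add, Finset.mul_sum, Finset.mul_sum]
        refine le_add_right (Finset.sum_le_sum fun i hi => ?_)
        rw [Nat.add_one_mul_choose_eq, mul_comm]
        gcongr
        have := Finset.mem_range.mp hi
        omega
      have h2 : ((k : ℝ) + 1) * (∑ i ∈ Finset.range (s + 1), k.choose i : ℕ) ≤
          (s + 1) * (∑ i ∈ Finset.range (s + 2), (k + 1).choose i : ℕ) := by exact_mod_cast h1
      rw [show r + 1 - (d + 1) = s + 1 by omega, show m - (d + 1) = k by omega]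
      rw [show r + 1 - d = s + 2 by omega, show m - d = k + 1 by omega] at ih
      have h3 : ((s : ℝ) + 1) / (k + 1) ≤ r / m := by
        rw [div_le_div_iff₀ hk0 hm, hs, hk]
        have : (s : ℝ) ≤ k := by exact_mod_cast (by omega : s ≤ k)
        push_cast
        nlinarith [mul_nonneg (Nat.cast_nonneg (α := ℝ) d) (sub_nonneg.mpr this)]
      calc ((∑ i ∈ Finset.range (s + 1), k.choose i : ℕ) : ℝ)
          ≤ ((s : ℝ) + 1) / (k + 1) * (∑ i ∈ Finset.range (s + 2), (k + 1).choose i : ℕ) := by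
            rw [div_mul_eq_mul_div, le_div_iff₀ hk0, mul_comm _ ((k : ℝ) + 1)]
            exact h2
        _ ≤ (r / m) * ((r / m) ^ d * (binomLe m r : ℝ)) := by gcongr
        _ = _ := by ring
    · rw [show r + 1 - (d + 1) = 0 by omega]
      simp only [Finset.range_zero, Finset.sum_empty, Nat.cast_zero]
      positivity

/-- The sum `∑_{j ≥ k} (j + 2) γ^{j-1}` equals `(c_γ k + d_γ) γ^{k-1}`: the latter satisfies the
corresponding telescoping identity. -/
theorem tail_recursion {γ : ℝ} (hγ : γ < 1) (d : ℕ) :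
    (cGamma γ * (d + 1 : ℕ) + dGamma γ) * γ ^ d =
      (d + 3 : ℕ) * γ ^ d + (cGamma γ * (d + 2 : ℕ) + dGamma γ) * γ ^ (d + 1) := by
  have h : 1 - γ ≠ 0 := by linarith
  rw [cGamma, dGamma, pow_succ]
  push_cast
  field_simp
  ring

theorem cGamma_nonneg {γ : ℝ} (hγ : γ < 1) : 0 ≤ cGamma γ :=
  div_nonneg zero_le_one (by linarith)

theorem one_le_dGamma {γ : ℝ} (hγ0 : 0 ≤ γ) (hγ : γ < 1) : 1 ≤ dGamma γ := by
  rw [dGamma, one_le_div (by have : 0 < 1 - γ := by linarith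
                             positivity)]
  nlinarith

/-- The recursion of `ncard_nearby_le` summed from weight `2^{-(d+1)}` down to `2^{-(m+1)}`, where only
the centre itself is left. -/
theorem ncard_nearby_le_rpow {m r : ℕ} (hr : r < m) {γ : ℝ} (hγ : γ = (r : ℝ) / m) (s d : ℕ)
    (hd : 1 ≤ d) (hs : d + s = m) (G : (Fin m → ZMod 2) → ZMod 2) :
    ((nearby (r + 1) (d + 1) G).ncard : ℝ) ≤ (2 : ℝ) ^ (51 * (m : ℝ) ^ 3 * s +
      17 * ((cGamma γ * (d + 1 : ℕ) + dGamma γ) * γ ^ d) * (binomLe m r : ℝ)) := by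
  have hm : (0 : ℝ) < m := by exact_mod_cast (by omega : 0 < m)
  have hγ0 : 0 ≤ γ := by rw [hγ]; positivity
  have hγ1 : γ < 1 := by rw [hγ, div_lt_one hm]; exact_mod_cast hr
  have hc := cGamma_nonneg hγ1
  have hd' := one_le_dGamma hγ0 hγ1
  induction s generalizing d G with
  | zero =>
    have h1 : (nearby (r + 1) (d + 1) G).ncard ≤ 1 := ncard_nearby_le_one _ _ (by
      simp only [Fintype.card_fun, ZMod.card, Fintype.card_fin]
      exact Nat.pow_lt_pow_right (by norm_num) (by omega)) G
    calc ((nearby (r + 1) (d + 1) G).ncard : ℝ) ≤ 1 := by exact_mod_cast h1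
      _ ≤ _ := Real.one_le_rpow (by norm_num) (by positivity)
  | succ s ih =>
    set E : ℝ := 51 * (m : ℝ) ^ 3 * s +
      17 * ((cGamma γ * (d + 2 : ℕ) + dGamma γ) * γ ^ (d + 1)) * (binomLe m r : ℝ) with hE
    set b := ∑ i ∈ Finset.range (r + 1 - d), (m - d).choose i with hb
    have hM : ∀ G' : (Fin m → ZMod 2) → ZMod 2,
        (nearby (r + 1) (d + 2) G').ncard ≤ ⌊(2 : ℝ) ^ E⌋₊ := fun G' =>
      Nat.le_floor (ih (d + 1) (by omega) (by omega) G')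
    have h1 := ncard_nearby_le (r + 1) d hd G hM
    simp only [Fintype.card_fun, ZMod.card, Fintype.card_fin, Module.finrank_fin_fun] at h1
    rw [← hb, ← pow_mul, ← pow_add, ← pow_mul] at h1
    have hbγ : (b : ℝ) ≤ γ ^ d * (binomLe m r : ℝ) := by
      rw [hγ]; exact sum_choose_sub_le hr d
    have hexp : (((m * d + b) * (17 * (d + 3)) : ℕ) : ℝ) ≤
        51 * (m : ℝ) ^ 3 + 17 * ((d + 3 : ℕ) * γ ^ d) * (binomLe m r : ℝ) := by
      have h2 : ((m * d * (17 * (d + 3)) : ℕ) : ℝ) ≤ 51 * (m : ℝ) ^ 3 := by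
        have h3 : m * d * (17 * (d + 3)) ≤ m * m * (17 * (m + 2 * m)) := by
          gcongr <;> omega
        calc ((m * d * (17 * (d + 3)) : ℕ) : ℝ) ≤ ((m * m * (17 * (m + 2 * m)) : ℕ) : ℝ) := by
              exact_mod_cast h3
          _ = _ := by push_cast; ring
      have h4 := mul_le_mul_of_nonneg_left hbγ (show (0 : ℝ) ≤ 17 * (d + 3 : ℕ) by positivity)
      rw [add_mul, Nat.cast_add]
      refine add_le_add h2 ((le_of_eq ?_).trans (h4.trans (le_of_eq ?_)))
      · push_cast; ring
      · ring
    calc ((nearby (r + 1) (d + 1) G).ncard : ℝ)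
        ≤ (2 : ℝ) ^ ((m * d + b) * (17 * (d + 3))) * ⌊(2 : ℝ) ^ E⌋₊ := by exact_mod_cast h1
      _ ≤ (2 : ℝ) ^ ((m * d + b) * (17 * (d + 3))) * (2 : ℝ) ^ E := by
          gcongr
          exact Nat.floor_le (by positivity)
      _ = (2 : ℝ) ^ ((((m * d + b) * (17 * (d + 3)) : ℕ) : ℝ) + E) := by
          rw [← Real.rpow_natCast, ← Real.rpow_add (by norm_num)]
      _ ≤ _ := by
          refine Real.rpow_le_rpow_of_exponent_le (by norm_num) ?_
          rw [tail_recursion hγ1 d, hE]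
          push_cast at hexp ⊢
          linarith

theorem density_eq_relWeight {m : ℕ} (f : (Fin m → ZMod 2) → ZMod 2) :
    density f = relWeight f := by
  classical
  rw [density, relWeight, Fintype.expect_eq_sum_div_card]
  simp only [ind, Finset.sum_boole, Fintype.card_fun, ZMod.card, Fintype.card_fin, Nat.cast_pow,
    Nat.cast_ofNat]
  rw [Set.ncard_eq_toFinset_card']
  simp

theorem weightDistribution_le_ncard_nearby (m r ℓ : ℕ) :
    weightDistribution m r ((2 : ℝ) ^ (-(ℓ : ℤ))) ≤
      (nearby (r + 1) ℓ (0 : (Fin m → ZMod 2) → ZMod 2)).ncard := by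
  refine Set.ncard_le_ncard (fun f hf => ⟨degLT_of_mem_lowDegreePolys hf.1, ?_⟩)
  rw [sub_zero, density_eq_relWeight]
  refine hf.2.trans_eq ?_
  rw [zpow_neg, zpow_natCast, one_div, inv_pow]

theorem ncard_nearby_le_two_pow_binomLe (m r k : ℕ) (G : (Fin m → ZMod 2) → ZMod 2) :
    (nearby (r + 1) k G).ncard ≤ 2 ^ binomLe m r := by
  have h := card_degLT_le (V := Fin m → ZMod 2) (r + 1)
  rw [Module.finrank_fin_fun] at h
  exact (Set.ncard_le_ncard (t := {f | DegLT (r + 1) f}) fun f hf => hf.1).trans h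

theorem theorem1p2 :
    ∃ C : ℝ, ∀ (m r ℓ : ℕ) (γ : ℝ), r < m → γ = (r : ℝ) / (m : ℝ) →
      (weightDistribution m r ((2 : ℝ) ^ (-(ℓ : ℤ))) : ℝ) ≤
        (2 : ℝ) ^ (C * (m : ℝ) ^ 4 +
          17 * (cGamma γ * (ℓ : ℝ) + dGamma γ) * γ ^ ((ℓ : ℤ) - 1) * (binomLe m r : ℝ)) := by
  refine ⟨51, fun m r ℓ γ hr hγ => ?_⟩
  have hm : (1 : ℝ) ≤ m := by exact_mod_cast (by omega : 1 ≤ m)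
  have hγ0 : 0 ≤ γ := by rw [hγ]; positivity
  have hγ1 : γ < 1 := by rw [hγ, div_lt_one (by linarith)]; exact_mod_cast hr
  have hc := cGamma_nonneg hγ1
  have hd := one_le_dGamma hγ0 hγ1
  have hm4 : (1 : ℝ) ≤ (m : ℝ) ^ 4 := one_le_pow₀ hm
  have hW := weightDistribution_le_ncard_nearby m r ℓ
  -- For `ℓ ≤ 1` the bound is weaker than the number of all polynomials.
  have htrivial : ∀ e : ℝ, (binomLe m r : ℝ) ≤ e →
      (weightDistribution m r ((2 : ℝ) ^ (-(ℓ : ℤ))) : ℝ) ≤ (2 : ℝ) ^ e := by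
    intro e he
    calc (weightDistribution m r ((2 : ℝ) ^ (-(ℓ : ℤ))) : ℝ) ≤ (2 : ℝ) ^ binomLe m r := by
          exact_mod_cast hW.trans (ncard_nearby_le_two_pow_binomLe m r ℓ 0)
      _ = (2 : ℝ) ^ (binomLe m r : ℝ) := (Real.rpow_natCast _ _).symm
      _ ≤ _ := Real.rpow_le_rpow_of_exponent_le (by norm_num) he
  have hB : (0 : ℝ) ≤ binomLe m r := by positivity
  rcases ℓ with _ | _ | d
  · apply htrivial
    rcases Nat.eq_zero_or_pos r with rfl | hr0
    · have : γ = 0 := by rw [hγ]; simp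
      -- Here the factor `0⁻¹ = 0` removes the second summand, and `m ^ 4 ≥ 1` suffices.
      subst this
      simp only [binomLe, zero_add, Finset.range_one, Finset.sum_singleton, Nat.choose_zero_right,
        Nat.cast_one, zero_sub, zpow_neg_one, inv_zero, mul_zero, zero_mul, add_zero,
        CharP.cast_eq_zero]
      linarith
    · have hγpos : 0 < γ := by
        rw [hγ]
        exact div_pos (by exact_mod_cast hr0) (by linarith)
      have hinv : 1 ≤ γ⁻¹ := (one_le_inv₀ hγpos).mpr hγ1.le
      have h1 : (1 : ℝ) ≤ 17 * dGamma γ * γ⁻¹ := by nlinarith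
      have h2 := mul_le_mul_of_nonneg_right h1 hB
      norm_num [zpow_neg_one]
      linarith
  · apply htrivial
    have h1 : (1 : ℝ) ≤ 17 * (cGamma γ + dGamma γ) := by linarith
    have h2 := mul_le_mul_of_nonneg_right h1 hB
    norm_num
    linarith
  · have hz : γ ^ (((d + 1 + 1 : ℕ) : ℤ) - 1) = γ ^ (d + 1) := by
      rw [← zpow_natCast]; congr 1; push_cast; ring
    rw [hz]
    rcases Nat.lt_or_ge m (d + 1) with hdm | hdm
    · have h1 : (nearby (r + 1) (d + 1 + 1) (0 : (Fin m → ZMod 2) → ZMod 2)).ncard ≤ 1 :=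
        ncard_nearby_le_one _ _ (by
          simp only [Fintype.card_fun, ZMod.card, Fintype.card_fin]
          exact Nat.pow_lt_pow_right (by norm_num) (by omega)) 0
      calc (weightDistribution m r ((2 : ℝ) ^ (-((d + 1 + 1 : ℕ) : ℤ))) : ℝ) ≤ 1 := by
            exact_mod_cast hW.trans h1
        _ ≤ _ := Real.one_le_rpow (by norm_num) (by positivity)
    · have h1 := ncard_nearby_le_rpow hr hγ (m - (d + 1)) (d + 1) (by omega) (by omega) 0
      refine (Nat.cast_le.mpr hW).trans (h1.trans
        (Real.rpow_le_rpow_of_exponent_le (by norm_num) ?_))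
      have h2 : ((m - (d + 1) : ℕ) : ℝ) ≤ m := by exact_mod_cast Nat.sub_le _ _
      have h3 : 51 * (m : ℝ) ^ 3 * ((m - (d + 1) : ℕ) : ℝ) ≤ 51 * (m : ℝ) ^ 4 := by
        calc _ ≤ 51 * (m : ℝ) ^ 3 * m := by gcongr
          _ = _ := by ring
      rw [← mul_assoc]
      linarith
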